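/- Setting. Let $X \subset \mathbb{R}^N$ be a Borel set, $\mu$ a $\sigma$-finite Borel measure on $X$, and $T\colon X \to X$ an injective, locally Lipschitz map. Let $k \ge 1$ be an integer and $\beta \in (0,1]$ be such that $\mathcal{H}^{\beta k}(X) = 0$, where $\mathcal{H}^s$ is the $s$-dimensional Hausdorff measure. Let $h\colon X \to \mathbb{R}$ be locally $\beta$-Hölder (every point of $X$ has a neighbourhood in $X$ on which $|h(x)-h(y)| \le C\|x-y\|^\beta$ for some constant $C$), and let $h_1,\ldots,h_m\colon X \to \mathbb{R}$ be locally $\beta$-Hölder functions forming a $2k$-interpolating family on $X$, i.e. for every $l \le 2k$, all distinct points $x_1,\ldots,x_l \in X$ and all $\xi_1,\ldots,\xi_l \in \mathbb{R}$ there is $(\alpha_1,\ldots,\alpha_m) \in \mathbb{R}^m$ with $\sum_{j=1}^m \alpha_j h_j(x_i) = \xi_i$ for $i=1,\ldots,l$ (if $X$ has at least $2k$ points, it suffices to require this for $l = 2k$). For $\alpha \in \mathbb{R}^m$ put $h_\alpha = h + \sum_{j=1}^m \alpha_j h_j$ and \[ \phi_\alpha^T\colon X \to \mathbb{R}^k,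 \qquad \phi_\alpha^T(x) = (h_\alpha(x), h_\alpha(Tx), \ldots, h_\alpha(T^{k-1}x)). \] For $p \ge 1$ let $\mathrm{Per}_p(T) = \{x \in X : T^p x = x,\ T^j x \ne x \text{ for } 1 \le j < p\}$, and consider the condition (P) $\ \mu|_{\mathrm{Per}_p(T)} \perp \mathcal{H}^{\beta p}$ for every $p = 1, \ldots, k-1$. The measure $\mu$ is $T$-invariant if $\mu(T^{-1}(Y)) = \mu(Y)$ for every Borel set $Y \subset X$; a $T$-invariant $\mu$ is ergodic if every Borel $Y \subset X$ with $T^{-1}(Y) = Y$ satisfies $\mu(Y) = 0$ or $\mu(X \setminus Y) = 0$. Statement. (a) If (P) holds and $\mu$ is $T$-invariant, then for Lebesgue almost every $\alpha \in \mathbb{R}^m$ there is a Borel set $X_\alpha \subset X$ with $\mu(X \setminus X_\alpha) = 0$ such that $\phi_\alpha^T$ is injective on $X_\alpha$ and $T(X_\alpha) \subset X_\alpha$. (b) If (P) holds and $\mu$ is finite and $T$-invariant, then for Lebesgue almost every $\alpha \in \mathbb{R}^m$ there is a Borel set $X_\alpha \subset X$ with $\mu(X \setminus X_\alpha) = 0$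 such that $\phi_\alpha^T$ is injective on $X_\alpha$ and $T(X_\alpha) = X_\alpha$. (c) If $\mu$ is $T$-invariant and ergodic, then condition (P) can be omitted: without assuming (P), for Lebesgue almost every $\alpha \in \mathbb{R}^m$ there is a Borel set $X_\alpha \subset X$ with $\mu(X \setminus X_\alpha) = 0$ such that $\phi_\alpha^T$ is injective on $X_\alpha$ and $T(X_\alpha) \subset X_\alpha$; if $\mu$ is moreover finite, then, again without assuming (P), $X_\alpha$ can be chosen with $T(X_\alpha) = X_\alpha$. -/

import Mathlib

open MeasureTheory Measure Set Topology
open scoped NNReal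

namespace Takens

/-- `f` is locally `β`-Hölder: every point has a neighbourhood on which
`dist (f y) (f z) ≤ C * dist y z ^ β` for some constant `C`. -/
def LocallyHolder {X Y : Type*} [PseudoEMetricSpace X] [PseudoEMetricSpace Y]
    (β : ℝ≥0) (f : X → Y) : Prop :=
  ∀ x : X, ∃ C : ℝ≥0, ∃ U ∈ 𝓝 x, HolderOnWith C β f U

/-- The functions `f 1, …, f m` form an `n`-interpolating family: arbitrary real values at any
`l ≤ n` distinct points are attained by a linear combination of the `f j`. If `X` has at least
`n` points, it is enough to ask this for `l = n`. -/
def IsInterpolating {X : Type*} {m : ℕ} (n : ℕ) (f : Fin m → X → ℝ) : Prop :=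
  ∀ l ≤ n, ∀ x : Fin l → X, Function.Injective x →
    ∀ ξ : Fin l → ℝ, ∃ α : Fin m → ℝ, ∀ i, ∑ j, α j * f j (x i) = ξ i

/-- The set of periodic points of `T` of minimal period `p` (used for `p ≥ 1`). -/
def Per {X : Type*} (T : X → X) (p : ℕ) : Set X :=
  {x | T^[p] x = x ∧ ∀ j, 1 ≤ j → j < p → T^[j] x ≠ x}

/-- The perturbed observable `h_α = h + ∑ j, α j • f j`. -/
def perturb {X : Type*} {m : ℕ} (h : X → ℝ) (f : Fin m → X → ℝ) (α : Fin m → ℝ) (x : X) : ℝ :=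
  h x + ∑ j, α j * f j x

/-- The delay-coordinate map `x ↦ (g x, g (T x), …, g (T^(k-1) x))`. -/
def delayMap {X : Type*} (T : X → X) (k : ℕ) (g : X → ℝ) (x : X) : Fin k → ℝ :=
  fun i => g (T^[i] x)

end Takens

/-! Fix `x` and vary only the second point `y`, so that a null condition in dimension `βk`, rather
than `2βk`, suffices. If `y` has `q` distinct first iterates, disjoint from those of `x`,
interpolation at `2q` points makes the linear part in `α` of the difference of delay vectors
surjective onto `ℝ^q`. On suitable `q`-dimensional slices of parameter space the bad parameter is
then a locally `β`-Hölder function of `y`, so an `H^{βq}`-null set of `y` yields a Lebesgue-null set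
of bad `α` (`ae_forall_add_apply_ne_zero`). Points whose orbit meets that of `x` are countable by
injectivity of `T`, and `q = 1` handles them.

Take `q = k` for points with no period below `k`, and `q = p` on `Per T p`, where (P) supplies the
null set. Fubini exchanges "for every `x`, a.e. `α`" with "for a.e. `α`, `μ`-a.e. `x`"; `σ`-compact
carriers provide the measurability.

Invariance of `μ` lets the injectivity set shrink to one fixed by `T`. Under ergodicity (P) is
automatic: if `μ` charges `Per T p`, it lives on one finite orbit. -/

namespace Takens

/-! ### Calculus of locally Hölder maps -/

section LocallyHolder

variable {X Y Z E : Type*} {β : ℝ≥0}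

theorem LocallyHolder.continuous [PseudoEMetricSpace X] [PseudoEMetricSpace Y] {f : X → Y}
    (hf : LocallyHolder β f) (hβ : 0 < β) : Continuous f := by
  rw [continuous_iff_continuousAt]
  intro x
  obtain ⟨C, U, hU, h⟩ := hf x
  exact (h.continuousOn hβ).continuousAt hU

theorem LocallyHolder.comp_locallyLipschitz [PseudoEMetricSpace X] [PseudoEMetricSpace Y]
    [PseudoEMetricSpace Z] {g : Y → Z} (hg : LocallyHolder β g) {f : X → Y}
    (hf : LocallyLipschitz f) : LocallyHolder β (g ∘ f) := by
  intro x
  obtain ⟨C, U, hU, hC⟩ := hg (f x)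
  obtain ⟨K, V, hV, hK⟩ := hf x
  refine ⟨C * K ^ (β : ℝ), V ∩ f ⁻¹' U,
    Filter.inter_mem hV (hf.continuous.continuousAt hU), ?_⟩
  have := hC.comp (hK.holderOnWith.mono (inter_subset_left (t := f ⁻¹' U))) (fun y hy => hy.2)
  simpa using this

theorem LocallyHolder.postcomp [PseudoEMetricSpace X] [PseudoEMetricSpace Y]
    [PseudoEMetricSpace Z] {g : Y → Z} {K : ℝ≥0} (hg : LipschitzWith K g) {f : X → Y}
    (hf : LocallyHolder β f) : LocallyHolder β (g ∘ f) := by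
  intro x
  obtain ⟨C, U, hU, hC⟩ := hf x
  exact ⟨_, U, hU, by simpa using hg.holderWith.comp_holderOnWith hC⟩

theorem LocallyHolder.prodMk [PseudoEMetricSpace X] [PseudoEMetricSpace Y]
    [PseudoEMetricSpace Z] {f : X → Y} {g : X → Z} (hf : LocallyHolder β f)
    (hg : LocallyHolder β g) : LocallyHolder β (fun x => (f x, g x)) := by
  intro x
  obtain ⟨C, U, hU, hC⟩ := hf x
  obtain ⟨C', U', hU', hC'⟩ := hg x
  refine ⟨max C C', U ∩ U', Filter.inter_mem hU hU', fun y hy z hz => ?_⟩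
  rw [Prod.edist_eq]
  refine max_le ((hC y hy.1 z hz.1).trans ?_) ((hC' y hy.2 z hz.2).trans ?_)
  · gcongr; exact le_max_left _ _
  · gcongr; exact le_max_right _ _

theorem LocallyHolder.pi [PseudoEMetricSpace X] {ι : Type*} [Fintype ι] {Y : ι → Type*}
    [∀ i, PseudoEMetricSpace (Y i)] {f : X → ∀ i, Y i}
    (hf : ∀ i, LocallyHolder β (fun x => f x i)) : LocallyHolder β f := by
  intro x
  choose C U hU hC using fun i => hf i x
  refine ⟨∑ i, C i, ⋂ i, U i, Filter.iInter_mem.2 hU, fun y hy z hz => ?_⟩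
  rw [edist_pi_le_iff]
  intro i
  refine (hC i y (mem_iInter.1 hy i) z (mem_iInter.1 hz i)).trans ?_
  gcongr
  exact Finset.single_le_sum (f := C) (fun _ _ => zero_le) (Finset.mem_univ i)

theorem LocallyHolder.const_sub [PseudoEMetricSpace X] [SeminormedAddCommGroup E] {f : X → E}
    (hf : LocallyHolder β f) (c : E) : LocallyHolder β (fun x => c - f x) := by
  intro x
  obtain ⟨C, U, hU, hC⟩ := hf x
  exact ⟨C, U, hU, fun y hy z hz => by simpa using hC y hy z hz⟩

theorem LocallyHolder.add [PseudoEMetricSpace X] [SeminormedAddCommGroup E] {f g : X → E}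
    (hf : LocallyHolder β f) (hg : LocallyHolder β g) :
    LocallyHolder β (fun x => f x + g x) := by
  intro x
  obtain ⟨C, U, hU, hC⟩ := hf x
  obtain ⟨C', U', hU', hC'⟩ := hg x
  refine ⟨C + C', U ∩ U', Filter.inter_mem hU hU', fun y hy z hz => ?_⟩
  refine (edist_add_add_le _ _ _ _).trans ?_
  push_cast
  rw [add_mul]
  exact add_le_add (hC y hy.1 z hz.1) (hC' y hy.2 z hz.2)

end LocallyHolder

/-! ### Null sets of bad parameters -/

/-- A map that is locally `β`-Hölder near the points of an `H^{βd}`-null set maps it to an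
`H^d`-null set. -/
theorem hausdorffMeasure_image_eq_zero_of_locally_holder {X Y : Type*} [EMetricSpace X]
    [SecondCountableTopology X] [MeasurableSpace X] [BorelSpace X] [EMetricSpace Y]
    [MeasurableSpace Y] [BorelSpace Y] {β : ℝ≥0} (hβ : 0 < β) {g : X → Y} {A : Set X} {d : ℝ}
    (hd : 0 ≤ d) (hg : ∀ x ∈ A, ∃ C : ℝ≥0, ∃ U ∈ 𝓝 x, HolderOnWith C β g U)
    (hA : μH[(β : ℝ) * d] A = 0) : μH[d] (g '' A) = 0 := by
  choose! C U hU hC using hg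
  obtain ⟨t, htA, htc, hAt⟩ := TopologicalSpace.countable_cover_nhdsWithin
    (f := U) (s := A) fun x hx => mem_nhdsWithin_of_mem_nhds (hU x hx)
  have : g '' A ⊆ ⋃ x ∈ t, g '' (A ∩ U x) := by
    rintro _ ⟨y, hy, rfl⟩
    obtain ⟨x, hx, hyx⟩ := mem_iUnion₂.1 (hAt hy)
    exact mem_iUnion₂.2 ⟨x, hx, y, ⟨hy, hyx⟩, rfl⟩
  refine measure_mono_null this ((measure_biUnion_null_iff htc).2 fun x hx => ?_)
  have h1 := ((hC x (htA hx)).mono (inter_subset_right (s := A))).hausdorffMeasure_image_le hβ hd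
  rw [measure_mono_null inter_subset_left hA, mul_zero] at h1
  exact le_antisymm h1 zero_le

/-- If all `M y` are invertible, the solutions `ξ` of `c y + M y ξ = 0`, for `y` in an
`H^{βq}`-null set, form a Lebesgue null set. -/
theorem ae_forall_add_apply_ne_zero_of_isUnit {X : Type*} [EMetricSpace X]
    [SecondCountableTopology X] [MeasurableSpace X] [BorelSpace X] {β : ℝ≥0} (hβ : 0 < β) {q : ℕ}
    {c : X → Fin q → ℝ} (hc : LocallyHolder β c)
    {M : X → (Fin q → ℝ) →L[ℝ] (Fin q → ℝ)} (hM : LocallyHolder β M)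
    {A : Set X} (hA : μH[(β : ℝ) * (q : ℝ)] A = 0) (hu : ∀ y ∈ A, IsUnit (M y)) :
    ∀ᵐ ξ : Fin q → ℝ, ∀ y ∈ A, c y + M y ξ ≠ 0 := by
  -- `Ψ (M, c)` is the unique solution of `c + M ξ = 0`. It is `C¹` near invertible `M`, hence
  -- locally Lipschitz there; the default value of `Ring.inverse` elsewhere plays no role.
  set Ψ : ((Fin q → ℝ) →L[ℝ] (Fin q → ℝ)) × (Fin q → ℝ) → (Fin q → ℝ) :=
    fun p => Ring.inverse p.1 (-p.2) with hΨ
  have hG : ∀ y ∈ A, ∃ C : ℝ≥0, ∃ U ∈ 𝓝 y, HolderOnWith C β (fun z => Ψ (M z, c z)) U := by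
    intro y hy
    obtain ⟨u, hu⟩ := hu y hy
    have hsmooth : ContDiffAt ℝ 1 Ψ (M y, c y) := by
      have h1 : ContDiffAt ℝ 1 Ring.inverse (M y) := hu ▸ contDiffAt_ringInverse ℝ u
      exact (ContDiffAt.comp (M y, c y) (f := Prod.fst) h1 contDiffAt_fst).clm_apply contDiffAt_snd.neg
    obtain ⟨K, t, ht, hK⟩ := hsmooth.exists_lipschitzOnWith
    have hp := hM.prodMk hc
    obtain ⟨C, U, hU, hC⟩ := hp y
    have hcomp := hK.holderOnWith.comp
      (hC.mono (inter_subset_left (t := (fun z => (M z, c z)) ⁻¹' t))) (fun z hz => hz.2)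
    rw [one_mul] at hcomp
    exact ⟨_, _, Filter.inter_mem hU ((hp.continuous hβ).continuousAt ht), hcomp⟩
  have h0 := hausdorffMeasure_image_eq_zero_of_locally_holder hβ (Nat.cast_nonneg q) hG hA
  have hvol : (μH[(q : ℝ)] : Measure (Fin q → ℝ)) = volume := by
    simpa using hausdorffMeasure_pi_real (ι := Fin q)
  rw [hvol] at h0
  rw [ae_iff]
  refine measure_mono_null ?_ h0
  intro ξ hξ
  simp only [mem_ofPred_eq, not_forall, not_not] at hξ
  obtain ⟨y, hy, hξ⟩ := hξ
  refine ⟨y, hy, ?_⟩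
  have h2 : -c y = M y ξ := (neg_eq_of_add_eq_zero_right hξ)
  simp only [hΨ, h2]
  rw [← ContinuousLinearMap.comp_apply, ← ContinuousLinearMap.mul_def, Ring.inverse_mul_cancel _ (hu y hy)]
  rfl

/-- The complement of the projection of a closed set along a `σ`-compact factor is Borel. -/
theorem measurableSet_forall_mem_notMem {X Y : Type*} [TopologicalSpace X] [TopologicalSpace Y]
    [MeasurableSpace Y] [BorelSpace Y] {K : Set X} (hK : IsSigmaCompact K)
    {F : Set (X × Y)} (hF : IsClosed F) : MeasurableSet {y | ∀ x ∈ K, (x, y) ∉ F} := by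
  obtain ⟨L, hL, rfl⟩ := hK
  have : {y | ∀ x ∈ ⋃ n, L n, (x, y) ∉ F} = ⋂ n, {y | ∀ x ∈ L n, (x, y) ∉ F} := by
    ext y
    simp only [mem_ofPred_eq, mem_iInter, mem_iUnion]
    grind
  rw [this]
  refine MeasurableSet.iInter fun n => IsOpen.measurableSet (isClosed_compl_iff.1 ?_)
  have : CompactSpace (L n) := isCompact_iff_compactSpace.1 (hL n)
  convert isClosedMap_snd_of_compactSpace (X := L n) (Y := Y)
    _ (hF.preimage ((continuous_subtype_val (p := (· ∈ L n))).prodMap continuous_id)) using 1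
  ext y
  simp

/-- If `Z` is `σ`-compact and `H^{βq}`-null, then for almost every `α` the equation
`w y + D y α = 0` has no solution `y ∈ Z` at which `D y` maps onto `ℝ^q`. -/
theorem ae_forall_add_apply_ne_zero {X : Type*} [EMetricSpace X]
    [SecondCountableTopology X] [MeasurableSpace X] [BorelSpace X] {β : ℝ≥0} (hβ : 0 < β) {q m : ℕ}
    {w : X → Fin q → ℝ} (hw : LocallyHolder β w)
    {D : X → (Fin m → ℝ) →L[ℝ] (Fin q → ℝ)} (hD : LocallyHolder β D)
    {Z : Set X} (hZ : IsSigmaCompact Z) (hZ0 : μH[(β : ℝ) * (q : ℝ)] Z = 0) :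
    ∀ᵐ α : Fin m → ℝ, ∀ y ∈ Z, Function.Surjective (D y) → w y + D y α ≠ 0 := by
  have hloc : ∀ y ∈ {y | y ∈ Z ∧ Function.Surjective (D y)}, ∃ U ∈ 𝓝 y,
      ∀ᵐ α : Fin m → ℝ, ∀ z ∈ Z ∩ U, w z + D z α ≠ 0 := by
    rintro y ⟨-, hy⟩
    -- Slice parameter space by the affine subspaces `α + R ξ`: since `D y ∘ R = 1`, `D z ∘ R` stays
    -- invertible for `z` near `y`.
    obtain ⟨R, hR⟩ := (D y : (Fin m → ℝ) →ₗ[ℝ] (Fin q → ℝ)).exists_rightInverse_of_surjective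
      (LinearMap.range_eq_top.2 hy)
    let R' : (Fin q → ℝ) →L[ℝ] (Fin m → ℝ) := LinearMap.toContinuousLinearMap R
    let Φ : ((Fin m → ℝ) →L[ℝ] (Fin q → ℝ)) →L[ℝ] ((Fin q → ℝ) →L[ℝ] (Fin q → ℝ)) :=
      (ContinuousLinearMap.compL ℝ (Fin q → ℝ) (Fin m → ℝ) (Fin q → ℝ)).flip R'
    have hM : LocallyHolder β (fun z => (D z).comp R') := hD.postcomp Φ.lipschitz
    have h1 : (D y).comp R' = 1 := by
      ext1 ξ
      exact congrArg (fun φ => φ ξ) hR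
    have hopen : IsOpen {z | IsUnit ((D z).comp R')} :=
      Units.isOpen.preimage (hM.continuous hβ)
    -- A closed neighbourhood keeps the bad set closed, as the projection argument for `hmeas`
    -- requires.
    obtain ⟨U, hU, hUc, hUs⟩ := exists_mem_nhds_isClosed_subset
      (hopen.mem_nhds (show IsUnit ((D y).comp R') by rw [h1]; exact isUnit_one))
    refine ⟨U, hU, ?_⟩
    have hcont : Continuous fun p : X × (Fin m → ℝ) => w p.1 + D p.1 p.2 :=
      ((hw.continuous hβ).comp continuous_fst).add
        (((hD.continuous hβ).comp continuous_fst).clm_apply continuous_snd)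
    have hmeas : MeasurableSet {α : Fin m → ℝ | ∀ z ∈ Z ∩ U, w z + D z α ≠ 0} := by
      have hcl : IsClosed {p : X × (Fin m → ℝ) | p.1 ∈ U ∧ w p.1 + D p.1 p.2 = 0} :=
        (hUc.preimage continuous_fst).inter (isClosed_eq hcont continuous_const)
      convert measurableSet_forall_mem_notMem hZ hcl using 1
      ext α
      simp only [mem_ofPred_eq, mem_inter_iff]
      grind
    refine ae_mem_of_ae_add_linearMap_mem (R : (Fin q → ℝ) →ₗ[ℝ] (Fin m → ℝ))
      (volume : Measure (Fin q → ℝ)) volume hmeas fun α => ?_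
    have hc : LocallyHolder β (fun z => w z + D z α) :=
      hw.add (hD.postcomp ((ContinuousLinearMap.apply ℝ (Fin q → ℝ) α).lipschitz))
    have := ae_forall_add_apply_ne_zero_of_isUnit hβ hc hM
      (measure_mono_null inter_subset_left hZ0 : μH[(β : ℝ) * (q : ℝ)] (Z ∩ U) = 0)
      (fun z hz => hUs hz.2)
    filter_upwards [this] with ξ hξ z hz
    have := hξ z hz
    rwa [add_assoc, ContinuousLinearMap.comp_apply, ← map_add] at this
  choose! U hU hUae using hloc
  obtain ⟨t, htA, htc, hAt⟩ := TopologicalSpace.countable_cover_nhdsWithin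
    (f := U) fun x hx => mem_nhdsWithin_of_mem_nhds (hU x hx)
  filter_upwards [(ae_ball_iff htc).2 fun y hy => hUae y (htA hy)] with α hα y hy hs
  obtain ⟨x, hx, hyx⟩ := mem_iUnion₂.1 (hAt ⟨hy, hs⟩)
  exact hα x hx y ⟨hy, hyx⟩

/-! ### Interpolation along orbits -/

theorem IsInterpolating.exists_forall_mem {X : Type*} {m n : ℕ} {f : Fin m → X → ℝ}
    (hf : IsInterpolating n f) (S : Finset X) (hS : S.card ≤ n) (ξ : X → ℝ) :
    ∃ α : Fin m → ℝ, ∀ x ∈ S, ∑ j, α j * f j x = ξ x := by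
  obtain ⟨α, hα⟩ := hf S.card hS (fun i => (S.equivFin.symm i : X))
    (Subtype.val_injective.comp S.equivFin.symm.injective) (fun i => ξ (S.equivFin.symm i))
  exact ⟨α, fun x hx => by simpa using hα (S.equivFin ⟨x, hx⟩)⟩

variable {X : Type*} {m : ℕ}

/-- The linear part in `α` of `i ↦ h_α (T^i x) - h_α (T^i y)`. -/
noncomputable def delayDiff (T : X → X) (f : Fin m → X → ℝ) (q : ℕ) (x y : X) :
    (Fin m → ℝ) →L[ℝ] (Fin q → ℝ) :=
  LinearMap.toContinuousLinearMap
    (Matrix.toLin' (Matrix.of fun (i : Fin q) j => f j (T^[i] x) - f j (T^[i] y)))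

theorem delayDiff_apply (T : X → X) (f : Fin m → X → ℝ) (q : ℕ) (x y : X) (α : Fin m → ℝ)
    (i : Fin q) : delayDiff T f q x y α i =
      ∑ j, α j * f j (T^[i] x) - ∑ j, α j * f j (T^[i] y) := by
  simp [delayDiff, Matrix.mulVec, dotProduct, ← Finset.sum_sub_distrib, mul_comm, mul_sub]

/-- Values on the orbit segment of `y` can be prescribed while those on the segment of `x` are kept
at zero. Only the iterates of `y` need be distinct; those of `x` may repeat. -/
theorem surjective_delayDiff {T : X → X} {f : Fin m → X → ℝ} {q n : ℕ}
    (hf : IsInterpolating n f) (hq : 2 * q ≤ n) {x y : X}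
    (hy : Function.Injective fun i : Fin q => T^[i] y)
    (hxy : ∀ i j : Fin q, T^[i] x ≠ T^[j] y) : Function.Surjective (delayDiff T f q x y) := by
  classical
  intro v
  let S : Finset X := Finset.univ.image (fun i : Fin q => T^[i] x) ∪
    Finset.univ.image (fun i : Fin q => T^[i] y)
  have hS : S.card ≤ n := by
    refine (Finset.card_union_le _ _).trans (le_trans (add_le_add Finset.card_image_le
      Finset.card_image_le) ?_)
    simpa [← two_mul] using hq
  obtain ⟨α, hα⟩ := hf.exists_forall_mem S hS
    -- The sign is `-v` because `delayDiff` subtracts the values along `y`.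
    (Function.extend (fun i : Fin q => T^[i] y) (-v) 0)
  refine ⟨α, funext fun i => ?_⟩
  rw [delayDiff_apply, hα _ (by simp [S]), hα _ (by simp [S]), hy.extend_apply,
    Function.extend_apply' _ _ _ (fun ⟨j, hj⟩ => hxy i j hj.symm)]
  simp

theorem locallyHolder_delayDiff [PseudoEMetricSpace X] {β : ℝ≥0} {T : X → X}
    (hT : LocallyLipschitz T) {f : Fin m → X → ℝ} (hf : ∀ j, LocallyHolder β (f j)) (q : ℕ)
    (x : X) : LocallyHolder β (delayDiff T f q x) := by
  let Φ : (Fin q → Fin m → ℝ) →ₗ[ℝ] ((Fin m → ℝ) →L[ℝ] (Fin q → ℝ)) :=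
    (LinearMap.toContinuousLinearMap (𝕜 := ℝ) (E := Fin m → ℝ) (F' := Fin q → ℝ)).toLinearMap ∘ₗ
      (Matrix.toLin' (R := ℝ) (m := Fin q) (n := Fin m)).toLinearMap ∘ₗ
      (Matrix.ofLinearEquiv ℝ).toLinearMap
  have hD : LocallyHolder β fun (y : X) (i : Fin q) (j : Fin m) =>
      f j (T^[i] x) - f j (T^[i] y) :=
    .pi fun i => .pi fun j => ((hf j).comp_locallyLipschitz (hT.iterate i)).const_sub _
  exact hD.postcomp (LinearMap.toContinuousLinearMap Φ).lipschitz

theorem ae_forall_exists_perturb_ne [EMetricSpace X] [SecondCountableTopology X]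
    [MeasurableSpace X] [BorelSpace X] {β : ℝ≥0} (hβ : 0 < β) {T : X → X}
    (hT : LocallyLipschitz T) {h : X → ℝ} (hh : LocallyHolder β h) {f : Fin m → X → ℝ}
    (hf : ∀ j, LocallyHolder β (f j)) {n : ℕ} (hint : IsInterpolating n f) {q : ℕ}
    (hq : 2 * q ≤ n) {Z : Set X} (hZ : IsSigmaCompact Z) (hZ0 : μH[(β : ℝ) * (q : ℝ)] Z = 0)
    (x : X) :
    ∀ᵐ α : Fin m → ℝ, ∀ y ∈ Z, (Function.Injective fun i : Fin q => T^[i] y) →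
      (∀ i j : Fin q, T^[i] x ≠ T^[j] y) →
      ∃ i : Fin q, perturb h f α (T^[i] x) ≠ perturb h f α (T^[i] y) := by
  have hw : LocallyHolder β fun (y : X) (i : Fin q) => h (T^[i] x) - h (T^[i] y) :=
    .pi fun i => (hh.comp_locallyLipschitz (hT.iterate i)).const_sub _
  filter_upwards [ae_forall_add_apply_ne_zero hβ hw (locallyHolder_delayDiff hT hf q x) hZ hZ0]
    with α hα y hy hinj hxy
  by_contra! hcon
  refine hα y hy (surjective_delayDiff hint hq hinj hxy) (funext fun i => ?_)
  have := hcon i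
  simp only [perturb] at this
  simp only [Pi.add_apply, delayDiff_apply, Pi.zero_apply]
  linarith

/-! ### Separation from a fixed point, and Fubini -/

/-- Only countably many points have an orbit that meets the orbit of `x`. -/
theorem countable_setOf_iterate_eq {T : X → X} (hT : Function.Injective T) (x : X) :
    {y | ∃ i j : ℕ, T^[i] x = T^[j] y}.Countable := by
  have : {y | ∃ i j : ℕ, T^[i] x = T^[j] y} = ⋃ (i : ℕ) (j : ℕ), {y | T^[i] x = T^[j] y} := by
    ext y; simp
  rw [this]
  refine countable_iUnion fun i => countable_iUnion fun j => Subsingleton.countable ?_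
  exact fun y hy z hz => (hT.iterate j) (hy.symm.trans hz)

/-- For each fixed `x`, almost every delay-coordinate map separates `x` from all other points of
the sets `Z q`. -/
theorem ae_forall_delayMap_ne [EMetricSpace X] [SecondCountableTopology X]
    [MeasurableSpace X] [BorelSpace X] {β : ℝ≥0} (hβ : 0 < β) {T : X → X}
    (hTinj : Function.Injective T) (hT : LocallyLipschitz T) {k : ℕ} (hk : 1 ≤ k) {h : X → ℝ}
    (hh : LocallyHolder β h) {f : Fin m → X → ℝ} (hf : ∀ j, LocallyHolder β (f j))
    (hint : IsInterpolating (2 * k) f) {Z : ℕ → Set X} (hZ : ∀ q, 1 ≤ q → q ≤ k → IsSigmaCompact (Z q))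
    (hZ0 : ∀ q, 1 ≤ q → q ≤ k → μH[(β : ℝ) * (q : ℝ)] (Z q) = 0)
    (hZinj : ∀ q, 1 ≤ q → q ≤ k → ∀ y ∈ Z q,
      Function.Injective fun i : Fin q => T^[i] y) (x : X) :
    ∀ᵐ α : Fin m → ℝ, ∀ y ∈ ⋃ q ∈ Icc 1 k, Z q, y ≠ x →
      delayMap T k (perturb h f α) x ≠ delayMap T k (perturb h f α) y := by
  set O : Set X := {y | ∃ i j : ℕ, T^[i] x = T^[j] y}
  have hO : O.Countable := countable_setOf_iterate_eq hTinj x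
  have hOs : IsSigmaCompact O := by
    have := isSigmaCompact_biUnion (S := fun y : X => {y}) hO fun y _ =>
      isCompact_singleton.isSigmaCompact
    rwa [biUnion_of_singleton] at this
  have hO0 : μH[(β : ℝ) * ((1 : ℕ) : ℝ)] O = 0 := by
    have : NullSingletonClass (μH[(β : ℝ) * ((1 : ℕ) : ℝ)] : Measure X) :=
      nullSingletonClass_hausdorff X (by simpa using hβ)
    exact hO.measure_zero _
  -- Orbit overlaps are harmless for `q = 1`: only `x ≠ y` is needed, and the countable set `O` is
  -- `H^β`-null.
  have h1 := ae_forall_exists_perturb_ne hβ hT hh hf hint (q := 1) (by lia) hOs hO0 x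
  have h2 : ∀ᵐ α : Fin m → ℝ, ∀ q ∈ Icc 1 k, ∀ y ∈ Z q,
      (Function.Injective fun i : Fin q => T^[i] y) → (∀ i j : Fin q, T^[i] x ≠ T^[j] y) →
      ∃ i : Fin q, perturb h f α (T^[i] x) ≠ perturb h f α (T^[i] y) :=
    (ae_ball_iff (to_countable _)).2 fun q hq =>
      ae_forall_exists_perturb_ne hβ hT hh hf hint (by have := hq.2; lia) (hZ q hq.1 hq.2)
        (hZ0 q hq.1 hq.2) x
  filter_upwards [h1, h2] with α h1 h2 y hy hyx heq
  obtain ⟨q, hq, hyq⟩ := mem_iUnion₂.1 hy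
  by_cases hyO : y ∈ O
  · obtain ⟨i, hi⟩ := h1 y hyO (Function.injective_of_subsingleton _) (by simpa using hyx.symm)
    refine hi ?_
    have := congrFun heq ⟨0, hk⟩
    simpa [delayMap] using this
  · obtain ⟨i, hi⟩ := h2 q hq y hyq (hZinj q hq.1 hq.2 y hyq) fun i j hij => hyO ⟨i, j, hij⟩
    exact hi (congrFun heq ⟨i, i.2.trans_le hq.2⟩)

theorem continuous_delayMap_perturb [TopologicalSpace X] {T : X → X} (hT : Continuous T) (k : ℕ)
    {h : X → ℝ} (hh : Continuous h) {f : Fin m → X → ℝ} (hf : ∀ j, Continuous (f j)) :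
    Continuous fun p : X × (Fin m → ℝ) => delayMap T k (perturb h f p.2) p.1 := by
  refine continuous_pi fun i => ?_
  have hTi : Continuous fun p : X × (Fin m → ℝ) => T^[i] p.1 :=
    (hT.iterate i).comp continuous_fst
  simp only [delayMap, perturb]
  fun_prop

/-- If the sets `Z q` carry `μ`, then almost every delay-coordinate map is injective on a Borel
set of full measure. -/
theorem ae_exists_injOn_delayMap [MetricSpace X] [SecondCountableTopology X]
    [MeasurableSpace X] [BorelSpace X] (μ : Measure X) [SFinite μ] {β : ℝ≥0} (hβ : 0 < β)
    {T : X → X} (hTinj : Function.Injective T) (hT : LocallyLipschitz T) {k : ℕ} (hk : 1 ≤ k)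
    {h : X → ℝ} (hh : LocallyHolder β h) {f : Fin m → X → ℝ} (hf : ∀ j, LocallyHolder β (f j))
    (hint : IsInterpolating (2 * k) f) {Z : ℕ → Set X} (hZ : ∀ q, 1 ≤ q → q ≤ k → IsSigmaCompact (Z q))
    (hZ0 : ∀ q, 1 ≤ q → q ≤ k → μH[(β : ℝ) * (q : ℝ)] (Z q) = 0)
    (hZinj : ∀ q, 1 ≤ q → q ≤ k → ∀ y ∈ Z q,
      Function.Injective fun i : Fin q => T^[i] y)
    (hZμ : μ (⋃ q ∈ Icc 1 k, Z q)ᶜ = 0) :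
    ∀ᵐ α : Fin m → ℝ, ∃ A : Set X, MeasurableSet A ∧ μ Aᶜ = 0 ∧
      InjOn (delayMap T k (perturb h f α)) A := by
  set W := ⋃ q ∈ Icc 1 k, Z q
  have hW : IsSigmaCompact W := isSigmaCompact_biUnion (to_countable _) fun q hq => hZ q hq.1 hq.2
  have hWm : MeasurableSet W := by
    obtain ⟨K, hK, hKW⟩ := hW
    exact hKW ▸ MeasurableSet.iUnion fun n => (hK n).measurableSet
  have hcont := continuous_delayMap_perturb hT.continuous k (hh.continuous hβ)
    fun j => (hf j).continuous hβ
  have hmeas : MeasurableSet {p : X × (Fin m → ℝ) | ∀ y ∈ W, y ≠ p.1 →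
      delayMap T k (perturb h f p.2) p.1 ≠ delayMap T k (perturb h f p.2) y} := by
    -- The condition `y ≠ x` is not closed, so it is exhausted by the closed conditions `dist ≥
    -- 1/(n+1)`.
    have hF : ∀ n : ℕ, IsClosed {p : X × (X × (Fin m → ℝ)) | 1 / ((n : ℝ) + 1) ≤ dist p.1 p.2.1 ∧
        delayMap T k (perturb h f p.2.2) p.2.1 = delayMap T k (perturb h f p.2.2) p.1} := fun n =>
      (isClosed_le continuous_const (continuous_fst.dist
        (continuous_fst.comp continuous_snd))).inter (isClosed_eq (hcont.comp continuous_snd)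
        (hcont.comp (continuous_fst.prodMk (continuous_snd.comp continuous_snd))))
    convert MeasurableSet.iInter fun n => measurableSet_forall_mem_notMem hW (hF n) using 1
    ext p
    simp only [mem_ofPred_eq, mem_iInter, not_and]
    constructor
    · intro hp n y hy hd
      refine hp y hy ?_
      rintro rfl
      rw [dist_self] at hd
      exact absurd hd (not_le.2 (by positivity))
    · intro hp y hy hne
      obtain ⟨n, hn⟩ := exists_nat_one_div_lt (dist_pos.2 hne)
      exact hp n y hy hn.le
  have hae := (ae_ae_comm (μ := μ) (ν := (volume : Measure (Fin m → ℝ))) hmeas).1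
    (Filter.Eventually.of_forall fun x =>
      ae_forall_delayMap_ne hβ hTinj hT hk hh hf hint hZ hZ0 hZinj x)
  filter_upwards [hae] with α hα
  refine ⟨W ∩ {x | ∀ y ∈ W, y ≠ x →
    delayMap T k (perturb h f α) x ≠ delayMap T k (perturb h f α) y},
    hWm.inter (measurable_prodMk_right hmeas), ?_, ?_⟩
  · rw [compl_inter]
    exact measure_union_null hZμ hα
  · intro x hx y hy hxy
    by_contra hne
    exact hx.2 y hy.1 (Ne.symm hne) hxy

/-! ### Compact exhaustion -/

/-- A Borel subset of a Borel set `X ⊆ E` is `σ`-compact up to a null set. -/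
theorem exists_isSigmaCompact_subset {E : Type*} [MetricSpace E] [CompleteSpace E]
    [SecondCountableTopology E] [MeasurableSpace E] [BorelSpace E] {X : Set E}
    (hX : MeasurableSet X) (μ : Measure X) [SFinite μ] {A : Set X} (hA : MeasurableSet A) :
    ∃ K ⊆ A, IsSigmaCompact K ∧ μ (A \ K) = 0 := by
  have hemb := MeasurableEmbedding.subtype_coe hX
  -- An equivalent finite measure, pushed to the complete space `E`, where compact inner regularity
  -- holds.
  set ν : Measure E := μ.toFinite.map Subtype.val
  have hB : MeasurableSet (Subtype.val '' A) := hemb.measurableSet_image.2 hA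
  choose K hKA hK hKν using fun n : ℕ => hB.exists_isCompact_sdiff_lt (μ := ν)
    (measure_ne_top _ _) (ε := ((n : ENNReal) + 1)⁻¹) (by simp)
  refine ⟨⋃ n, Subtype.val ⁻¹' K n, ?_, ?_, ?_⟩
  · refine iUnion_subset fun n x hx => ?_
    obtain ⟨y, hy, hyx⟩ := hKA n hx
    exact Subtype.val_injective hyx ▸ hy
  · refine isSigmaCompact_iUnion_of_isCompact _ fun n => ?_
    exact IsEmbedding.subtypeVal.isInducing.isCompact_preimage_iff
      ((hKA n).trans (image_subset_range _ _)) |>.2 (hK n)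
  · refine absolutelyContinuous_toFinite μ ?_
    refine le_antisymm (ENNReal.le_of_forall_pos_le_add fun ε hε _ => ?_) zero_le
    obtain ⟨n, hn⟩ := ENNReal.exists_inv_nat_lt (ENNReal.coe_pos.2 hε).ne'
    have h1 : A \ ⋃ n, Subtype.val ⁻¹' K n ⊆ Subtype.val ⁻¹' (Subtype.val '' A \ K n) :=
      fun x hx => ⟨mem_image_of_mem _ hx.1, fun h => hx.2 (mem_iUnion.2 ⟨n, h⟩)⟩
    calc μ.toFinite (A \ ⋃ n, Subtype.val ⁻¹' K n)
        ≤ μ.toFinite (Subtype.val ⁻¹' (Subtype.val '' A \ K n)) := measure_mono h1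
      _ = ν (Subtype.val '' A \ K n) := (hemb.map_apply _ _).symm
      _ ≤ ((n : ENNReal) + 1)⁻¹ := (hKν n).le
      _ ≤ (n : ENNReal)⁻¹ := ENNReal.inv_le_inv.2 le_self_add
      _ ≤ 0 + ε := by rw [zero_add]; exact hn.le

/-! ### Periodic points, ergodicity and invariant sets -/

section Periodic

variable {X : Type*} {T : X → X}

theorem injective_iterate_of_forall_ne (hT : Function.Injective T) {q : ℕ} {y : X}
    (hy : ∀ d, 1 ≤ d → d < q → T^[d] y ≠ y) : Function.Injective fun i : Fin q => T^[i] y := by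
  have key : ∀ i j : ℕ, i < j → j < q → T^[i] y ≠ T^[j] y := by
    intro i j hij hj h
    refine hy (j - i) (by lia) (by lia) (hT.iterate i ?_)
    rw [← Function.iterate_add_apply, Nat.add_sub_cancel' hij.le, h]
  intro i j hij
  rcases lt_trichotomy (i : ℕ) j with h | h | h
  · exact absurd hij (key i j h j.2)
  · exact Fin.ext h
  · exact absurd hij.symm (key j i h i.2)

theorem exists_mem_Per {d : ℕ} {y : X} (hd : 1 ≤ d) (hy : T^[d] y = y) :
    ∃ p, 1 ≤ p ∧ p ≤ d ∧ y ∈ Per T p := by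
  classical
  have hex : ∃ p, 1 ≤ p ∧ T^[p] y = y := ⟨d, hd, hy⟩
  exact ⟨Nat.find hex, (Nat.find_spec hex).1, Nat.find_min' hex ⟨hd, hy⟩,
    (Nat.find_spec hex).2, fun j hj hjp h => Nat.find_min hex hjp ⟨hj, h⟩⟩

theorem preimage_Per (hT : Function.Injective T) (p : ℕ) : T ⁻¹' Per T p = Per T p := by
  ext x
  have : ∀ j, T^[j] (T x) = T x ↔ T^[j] x = x := fun j => by
    rw [← Function.iterate_succ_apply, Function.iterate_succ_apply', hT.eq_iff]
  simp [Per, this]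

theorem measurableSet_Per [MetricSpace X] [SecondCountableTopology X] [MeasurableSpace X]
    [BorelSpace X] (hT : Continuous T) (p : ℕ) : MeasurableSet (Per T p) := by
  have h1 : ∀ j, MeasurableSet {x | T^[j] x = x} := fun j =>
    (isClosed_eq (hT.iterate j) continuous_id).measurableSet
  have : Per T p = {x | T^[p] x = x} ∩ ⋂ j ∈ Ico 1 p, {x | T^[j] x = x}ᶜ := by
    ext x
    simp [Per]
  rw [this]
  exact (h1 p).inter (MeasurableSet.biInter (to_countable _) fun j _ => (h1 j).compl)

/-- An ergodic measure that charges the `p`-periodic points is carried by a single orbit. -/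
theorem exists_finite_of_measure_Per_ne_zero [MetricSpace X] [SecondCountableTopology X]
    [MeasurableSpace X] [BorelSpace X] {μ : Measure X} (hTinj : Function.Injective T)
    (hT : Continuous T) (hμ : Ergodic T μ) {p : ℕ} (hp : 1 ≤ p) (hper : μ (Per T p) ≠ 0) :
    ∃ O : Set X, O.Finite ∧ μ Oᶜ = 0 := by
  have hP : ∀ᵐ x ∂μ, x ∈ Per T p := by
    refine (hμ.toPreErgodic.ae_mem_or_ae_notMem (measurableSet_Per hT p)
      (preimage_Per hTinj p)).resolve_right fun h => hper ?_
    simpa [ae_iff] using h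
  -- Whether an orbit visits a basic open set is almost surely constant, so almost all orbits visit
  -- the same basic sets.
  have hS : ∀ U ∈ TopologicalSpace.countableBasis X, ∃ P : Prop,
      ∀ᵐ x ∂μ, ((∃ i : ℕ, T^[i] x ∈ U) ↔ P) := by
    intro U hU
    have hUo : IsOpen U := TopologicalSpace.isOpen_of_mem_countableBasis hU
    have hm : IsOpen {x | ∃ i : ℕ, T^[i] x ∈ U} := by
      have : {x | ∃ i : ℕ, T^[i] x ∈ U} = ⋃ i : ℕ, T^[i] ⁻¹' U := by ext; simp
      rw [this]
      exact isOpen_iUnion fun i => hUo.preimage (hT.iterate i)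
    have hinv : T ⁻¹' {x | ∃ i : ℕ, T^[i] x ∈ U} =ᵐ[μ] {x | ∃ i : ℕ, T^[i] x ∈ U} := by
      refine Filter.Eventually.set_eq ?_
      filter_upwards [hP] with x hx
      -- A visit of `x` at time `i` recurs at time `i + p`, which is time `i + (p - 1)` for `T x`.
      refine ⟨fun ⟨i, hi⟩ => ⟨i + 1, hi⟩, fun ⟨i, hi⟩ => ⟨i + (p - 1), ?_⟩⟩
      rw [← Function.iterate_succ_apply, show (i + (p - 1)).succ = i + p by lia,
        Function.iterate_add_apply, hx.1]
      exact hi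
    rcases hμ.quasiErgodic.ae_mem_or_ae_notMem₀ hm.measurableSet.nullMeasurableSet hinv with h | h
    · exact ⟨True, h.mono fun x hx => iff_of_true hx trivial⟩
    · exact ⟨False, h.mono fun x hx => iff_of_false hx id⟩
  choose! P hPU using hS
  have hgood := hP.and ((ae_ball_iff (TopologicalSpace.countable_countableBasis X)).2 hPU)
  have : (ae μ).NeBot := ae_neBot.2 fun h => hper (by simp [h])
  obtain ⟨x, hx, hxU⟩ := hgood.exists
  refine ⟨(fun i => T^[i] x) '' Iio p, (finite_Iio p).image _, ?_⟩
  refine measure_mono_null ?_ hgood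
  rintro y hyO ⟨-, hyU⟩
  -- A basic set around `y` missing the finite orbit of `x` is visited by `y` at time `0`, hence
  -- also by `x`: a contradiction.
  obtain ⟨U, hU, hyUm, hUO⟩ := (TopologicalSpace.isBasis_countableBasis X).exists_subset_of_mem_open
    hyO ((finite_Iio p).image fun i => T^[i] x).isClosed.isOpen_compl
  obtain ⟨i, hi⟩ := (hxU U hU).2 ((hyU U hU).1 ⟨0, hyUm⟩)
  refine hUO hi ⟨i % p, Nat.mod_lt _ hp, ?_⟩
  exact Function.IsPeriodicPt.iterate_mod_apply hx.1 i

theorem mutuallySingular_restrict_Per_of_ergodic [MetricSpace X] [SecondCountableTopology X]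
    [MeasurableSpace X] [BorelSpace X] {μ : Measure X} (hTinj : Function.Injective T)
    (hT : Continuous T) (hμ : Ergodic T μ) {p : ℕ} (hp : 1 ≤ p) {d : ℝ} (hd : 0 < d) :
    μ.restrict (Per T p) ⟂ₘ (μH[d] : Measure X) := by
  by_cases hper : μ (Per T p) = 0
  · rw [restrict_eq_zero.2 hper]
    exact MutuallySingular.zero_left
  · obtain ⟨O, hO, hμO⟩ := exists_finite_of_measure_Per_ne_zero hTinj hT hμ hp hper
    refine ⟨Oᶜ, hO.measurableSet.compl, ?_, ?_⟩
    · exact le_antisymm ((restrict_apply_le _ _).trans hμO.le) zero_le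
    · have := nullSingletonClass_hausdorff X hd
      rw [compl_compl]
      exact hO.measure_zero _

/-- A Borel set of full measure contains a `T`-fixed one. -/
theorem exists_subset_image_eq [MeasurableSpace X] [StandardBorelSpace X] {μ : Measure X}
    (hT : Function.Injective T) (hμ : MeasurePreserving T μ μ) {A : Set X}
    (hA : MeasurableSet A) (hμA : μ Aᶜ = 0) :
    ∃ B ⊆ A, MeasurableSet B ∧ μ Bᶜ = 0 ∧ T '' B = B := by
  set B := ⋂ n : ℕ, T^[n] ⁻¹' A
  have hB : MeasurableSet B := MeasurableSet.iInter fun n => (hμ.iterate n).measurable hA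
  have hμB : μ Bᶜ = 0 := by
    rw [compl_iInter]
    refine measure_iUnion_null fun n => ?_
    rw [← preimage_compl, (hμ.iterate n).measure_preimage hA.compl.nullMeasurableSet, hμA]
  have hTB : ∀ x ∈ B, T x ∈ B := fun x hx => mem_iInter.2 fun n => mem_iInter.1 hx (n + 1)
  have hBn : ∀ n, MeasurableSet (T^[n] '' B) := fun n =>
    ((hμ.iterate n).measurable.measurableEmbedding (hT.iterate n)).measurableSet_image.2 hB
  -- `B` is only forward invariant; intersecting its images gives equality. Each image has full
  -- measure because its `T^[n]`-preimage is `B`.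
  refine ⟨⋂ n : ℕ, T^[n] '' B, ?_, MeasurableSet.iInter hBn, ?_, ?_⟩
  · intro x hx
    obtain ⟨b, hb, rfl⟩ := mem_iInter.1 hx 0
    exact mem_iInter.1 hb 0
  · rw [compl_iInter]
    refine measure_iUnion_null fun n => ?_
    rw [← (hμ.iterate n).measure_preimage (hBn n).compl.nullMeasurableSet, preimage_compl,
      preimage_image_eq _ (hT.iterate n), hμB]
  · refine Subset.antisymm ?_ fun y hy => ?_
    · rintro _ ⟨x, hx, rfl⟩
      refine mem_iInter.2 fun n => ?_
      obtain ⟨b, hb, rfl⟩ := mem_iInter.1 hx n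
      exact ⟨T b, hTB b hb, (Function.Commute.iterate_self T n b)⟩
    · obtain ⟨b, hb, rfl⟩ := mem_iInter.1 hy 1
      refine ⟨b, mem_iInter.2 fun n => ?_, rfl⟩
      -- Writing `y = T^[n+1] c`, injectivity forces the preimage `b` of `y` to be `T^[n] c`.
      obtain ⟨c, hc, hcb⟩ := mem_iInter.1 hy (n + 1)
      rw [Function.iterate_succ_apply'] at hcb
      exact ⟨c, hc, hT hcb⟩

end Periodic

/-! ### Decomposition by period and conclusion -/

/-- Under condition (P), `μ` is carried by `σ`-compact sets `Z q` of vanishing `H^{βq}`-measure on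
which the first `q` iterates are distinct. -/
theorem exists_isSigmaCompact_decomposition {E : Type*} [MetricSpace E] [CompleteSpace E]
    [SecondCountableTopology E] [MeasurableSpace E] [BorelSpace E] {X : Set E}
    (hX : MeasurableSet X) (μ : Measure X) [SFinite μ] {T : X → X}
    (hTinj : Function.Injective T) (hT : Continuous T) {k : ℕ} (hk : 1 ≤ k) {β : ℝ}
    (hdim : μH[β * (k : ℝ)] (univ : Set X) = 0)
    (hP : ∀ p : ℕ, 1 ≤ p → p < k →
      μ.restrict (Per T p) ⟂ₘ (μH[β * (p : ℝ)] : Measure X)) :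
    ∃ Z : ℕ → Set X, (∀ q, 1 ≤ q → q ≤ k → IsSigmaCompact (Z q)) ∧
      (∀ q, 1 ≤ q → q ≤ k → μH[β * (q : ℝ)] (Z q) = 0) ∧
      (∀ q, 1 ≤ q → q ≤ k → ∀ y ∈ Z q, Function.Injective fun i : Fin q => T^[i] y) ∧
      μ (⋃ q ∈ Icc 1 k, Z q)ᶜ = 0 := by
  -- Index `k` collects all points without a minimal period in `[1, k)`, so indices `1, …, k` cover
  -- `X`.
  set R : ℕ → Set X := fun q => if q < k then Per T q else ⋂ p ∈ Ico 1 k, (Per T p)ᶜ with hR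
  have hex : ∀ q, 1 ≤ q → q ≤ k → ∃ Z : Set X, IsSigmaCompact Z ∧ μH[β * (q : ℝ)] Z = 0 ∧
      (∀ y ∈ Z, Function.Injective fun i : Fin q => T^[i] y) ∧ μ (R q \ Z) = 0 := by
    intro q hq hqk
    rcases hqk.lt_or_eq with hlt | rfl
    -- Singularity puts the mass of `Per T q` outside `s`, where `H^{βq}` vanishes.
    · obtain ⟨s, hs, hs0, hs1⟩ := hP q hq hlt
      obtain ⟨Z, hZA, hZ, hZμ⟩ := exists_isSigmaCompact_subset hX μ
        ((measurableSet_Per hT q).diff hs)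
      refine ⟨Z, hZ, measure_mono_null (fun y hy => (hZA hy).2) hs1,
        fun y hy => injective_iterate_of_forall_ne hTinj (hZA hy).1.2, ?_⟩
      rw [restrict_apply hs] at hs0
      simp only [hR, hlt, if_true]
      refine measure_mono_null (fun y hy => ?_) (measure_union_null hZμ hs0)
      by_cases hys : y ∈ s
      · exact Or.inr ⟨hys, hy.1⟩
      · exact Or.inl ⟨⟨hy.1, hys⟩, hy.2⟩
    · have hm : MeasurableSet (⋂ p ∈ Ico 1 q, (Per T p)ᶜ) :=
        MeasurableSet.biInter (to_countable _) fun p _ => (measurableSet_Per hT p).compl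
      obtain ⟨Z, hZA, hZ, hZμ⟩ := exists_isSigmaCompact_subset hX μ hm
      refine ⟨Z, hZ, measure_mono_null (subset_univ _) hdim, fun y hy =>
        injective_iterate_of_forall_ne hTinj fun d hd hdq h => ?_, by simpa [hR] using hZμ⟩
      obtain ⟨p, hp, hpd, hyp⟩ := exists_mem_Per hd h
      exact mem_iInter₂.1 (hZA hy) p ⟨hp, hpd.trans_lt hdq⟩ hyp
  choose! Z hZ hZ0 hZinj hZμ using hex
  refine ⟨Z, hZ, hZ0, hZinj, ?_⟩
  refine measure_mono_null (t := ⋃ q ∈ Icc 1 k, R q \ Z q) (fun y hy => ?_)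
    ((measure_biUnion_null_iff (to_countable _)).2 fun q hq => hZμ q hq.1 hq.2)
  simp only [mem_compl_iff, mem_iUnion, not_exists] at hy
  by_cases hper : ∃ p ∈ Ico 1 k, y ∈ Per T p
  · obtain ⟨p, hp, hyp⟩ := hper
    have hpk : p ∈ Icc 1 k := ⟨hp.1, hp.2.le⟩
    exact mem_iUnion₂.2 ⟨p, hpk, by simpa [hR, hp.2] using hyp, hy p hpk⟩
  · push Not at hper
    have hkk : k ∈ Icc 1 k := ⟨hk, le_rfl⟩
    refine mem_iUnion₂.2 ⟨k, hkk, ?_, hy k hkk⟩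
    simp only [hR, lt_irrefl, if_false]
    exact mem_iInter₂.2 hper

/-- Under condition (P), almost every delay-coordinate map is injective on a Borel set `A` of full
measure with `T '' A = A`. -/
theorem ae_exists_injOn_image_eq {E : Type*} [MetricSpace E] [CompleteSpace E]
    [SecondCountableTopology E] [MeasurableSpace E] [BorelSpace E] {X : Set E}
    (hX : MeasurableSet X) (μ : Measure X) [SFinite μ] {T : X → X}
    (hTinj : Function.Injective T) (hT : LocallyLipschitz T) {k : ℕ} (hk : 1 ≤ k) {β : ℝ≥0}
    (hβ : 0 < β) (hdim : μH[(β : ℝ) * (k : ℝ)] X = 0) {h : X → ℝ} (hh : LocallyHolder β h)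
    {m : ℕ} {f : Fin m → X → ℝ} (hf : ∀ j, LocallyHolder β (f j))
    (hint : IsInterpolating (2 * k) f)
    (hP : ∀ p : ℕ, 1 ≤ p → p < k →
      μ.restrict (Per T p) ⟂ₘ (μH[(β : ℝ) * (p : ℝ)] : Measure X))
    (hμ : MeasurePreserving T μ μ) :
    ∀ᵐ α : Fin m → ℝ, ∃ A : Set X, MeasurableSet A ∧ μ Aᶜ = 0 ∧
      InjOn (delayMap T k (perturb h f α)) A ∧ T '' A = A := by
  have hdim' : μH[(β : ℝ) * (k : ℝ)] (univ : Set X) = 0 := by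
    rw [← isometry_subtype_coe.hausdorffMeasure_image (Or.inl (by positivity)), image_univ,
      Subtype.range_coe]
    exact hdim
  obtain ⟨Z, hZ, hZ0, hZinj, hZμ⟩ :=
    exists_isSigmaCompact_decomposition hX μ hTinj hT.continuous hk hdim' hP
  have := hX.standardBorel
  filter_upwards [ae_exists_injOn_delayMap μ hβ hTinj hT hk hh hf hint hZ hZ0 hZinj hZμ]
    with α ⟨A, hA, hμA, hinj⟩
  obtain ⟨B, hBA, hB, hμB, hTB⟩ := exists_subset_image_eq hTinj hμ hA hμA
  exact ⟨B, hB, hμB, hinj.mono hBA, hTB⟩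

end Takens
theorem mainTheorem4 (N : ℕ) (X : Set (EuclideanSpace ℝ (Fin N))) (hX : MeasurableSet X)
    (μ : Measure X) [SigmaFinite μ]
    (T : X → X) (hTinj : Function.Injective T) (hTlip : LocallyLipschitz T)
    (k : ℕ) (hk : 1 ≤ k) (β : ℝ≥0) (hβ0 : 0 < β) (hβ1 : β ≤ 1)
    (hdim : μH[(β : ℝ) * (k : ℝ)] X = 0)
    (h : X → ℝ) (hh : Takens.LocallyHolder β h)
    (m : ℕ) (f : Fin m → X → ℝ) (hf : ∀ j, Takens.LocallyHolder β (f j))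
    (hint : Takens.IsInterpolating (2 * k) f) :
    -- (a) invariant measure
    ((∀ p : ℕ, 1 ≤ p → p < k →
        μ.restrict (Takens.Per T p) ⟂ₘ (μH[(β : ℝ) * (p : ℝ)] : Measure X)) →
      MeasurePreserving T μ μ →
      ∀ᵐ α : Fin m → ℝ, ∃ Xα : Set X, MeasurableSet Xα ∧ μ Xαᶜ = 0 ∧
        InjOn (Takens.delayMap T k (Takens.perturb h f α)) Xα ∧ T '' Xα ⊆ Xα) ∧
    -- (b) finite invariant measure
    ((∀ p : ℕ, 1 ≤ p → p < k →
        μ.restrict (Takens.Per T p) ⟂ₘ (μH[(β : ℝ) * (p : ℝ)] : Measure X)) →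
      IsFiniteMeasure μ → MeasurePreserving T μ μ →
      ∀ᵐ α : Fin m → ℝ, ∃ Xα : Set X, MeasurableSet Xα ∧ μ Xαᶜ = 0 ∧
        InjOn (Takens.delayMap T k (Takens.perturb h f α)) Xα ∧ T '' Xα = Xα) ∧
    -- (c) ergodic invariant measure: no assumption on the periodic points
    (Ergodic T μ →
      (∀ᵐ α : Fin m → ℝ, ∃ Xα : Set X, MeasurableSet Xα ∧ μ Xαᶜ = 0 ∧
        InjOn (Takens.delayMap T k (Takens.perturb h f α)) Xα ∧ T '' Xα ⊆ Xα) ∧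
      (IsFiniteMeasure μ →
        ∀ᵐ α : Fin m → ℝ, ∃ Xα : Set X, MeasurableSet Xα ∧ μ Xαᶜ = 0 ∧
          InjOn (Takens.delayMap T k (Takens.perturb h f α)) Xα ∧ T '' Xα = Xα)) := by
  have key := fun hP hμ => Takens.ae_exists_injOn_image_eq hX μ hTinj hTlip hk hβ0 hdim hh hf hint
    hP hμ
  have hPerg : Ergodic T μ → ∀ p : ℕ, 1 ≤ p → p < k →
      μ.restrict (Takens.Per T p) ⟂ₘ (μH[(β : ℝ) * (p : ℝ)] : Measure X) := fun hμ p hp _ =>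
    Takens.mutuallySingular_restrict_Per_of_ergodic hTinj hTlip.continuous hμ hp (by positivity)
  refine ⟨fun hP hμ => ?_, fun hP _ hμ => key hP hμ, fun hμ => ⟨?_, fun _ => ?_⟩⟩
  · filter_upwards [key hP hμ] with α ⟨A, hA, hμA, hinj, hTA⟩
    exact ⟨A, hA, hμA, hinj, hTA.subset⟩
  · filter_upwards [key (hPerg hμ) hμ.toMeasurePreserving] with α ⟨A, hA, hμA, hinj, hTA⟩
    exact ⟨A, hA, hμA, hinj, hTA.subset⟩
  · exact key (hPerg hμ) hμ.toMeasurePreserving
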